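/- Let $D=(V,A)$ be a finite directed graph, where parallel and opposite arcs are allowed but loops are not, let $w\in\mathbb{Z}_{\ge 0}^A$, and for $F\subseteq A$ write $w(F)=\sum_{a\in F}w_a$. For $U\subseteq V$ let $\delta^+(U)$ and $\delta^-(U)$ denote the sets of arcs leaving and entering $U$, respectively, and write $\delta^\pm(v)=\delta^\pm(\{v\})$. A \emph{dicut} is a set of the form $\delta^+(U)$ with $\emptyset\ne U\subsetneq V$ and $\delta^-(U)=\emptyset$; a \emph{dijoin} is a subset of $A$ that intersects every dicut. For an integer $\tau\ge 2$ let $$\rho(\tau,D,w)=\frac1\tau\sum_{v\in V}\Big(\big(w(\delta^+(v))-w(\delta^-(v))\big)\bmod \tau\Big),$$ where $n \bmod \tau$ denotes the integer in $\{0,1,\ldots,\tau-1\}$ congruent to $n$ modulo $\tau$. \textbf{Theorem.} Let $\tau\ge 2$ be an integer, and suppose that every dicut $C$ of $D$ satisfies $w(C)\ge\tau$ and that $\rho(\tau,D,w)\le 2$. Then $(D,w)$ has a $w$-weighted packing of dijoins of size $\tau$, that is, there are $\tau$ (not necessarily distinct) dijoins $J_1,\ldots,J_\tau$ of $D$ such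 that every arc $a\in A$ belongs to at most $w_a$ of them. -/

import Mathlib

/-- A directed multigraph with vertex set `V` and arc set `A`: the arc `a` goes from `tail a` to
`head a`. Parallel and opposite arcs are allowed, loops are not. -/
structure MultiDigraph (V A : Type*) where
  tail : A → V
  head : A → V
  loopless : ∀ a, tail a ≠ head a

namespace MultiDigraph

variable {V A : Type*} [Fintype V] [DecidableEq V] [Fintype A]

/-- The set `δ⁺(U)` of arcs leaving `U`. -/
def outCut (D : MultiDigraph V A) (U : Finset V) : Finset A :=
  Finset.univ.filter (fun a => D.tail a ∈ U ∧ D.head a ∉ U)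

/-- The set `δ⁻(U)` of arcs entering `U`. -/
def inCut (D : MultiDigraph V A) (U : Finset V) : Finset A :=
  Finset.univ.filter (fun a => D.head a ∈ U ∧ D.tail a ∉ U)

/-- A dicut is a cut `δ⁺(U)` for some nonempty proper vertex subset `U` with `δ⁻(U) = ∅`. -/
def IsDicut (D : MultiDigraph V A) (C : Finset A) : Prop :=
  ∃ U : Finset V, U.Nonempty ∧ U ≠ Finset.univ ∧ D.inCut U = ∅ ∧ C = D.outCut U

/-- A dijoin is an arc subset that intersects every dicut. -/
def IsDijoin (D : MultiDigraph V A) (J : Finset A) : Prop :=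
  ∀ C : Finset A, D.IsDicut C → ∃ a ∈ J, a ∈ C

/-- The `w`-weight of an arc subset. -/
def weight (w : A → ℕ) (F : Finset A) : ℕ := ∑ a ∈ F, w a

/-- `ρ(τ, D, w) = (1/τ) ∑ᵥ ((w(δ⁺(v)) - w(δ⁻(v))) mod τ)`, where for `τ ≥ 1` the residue is taken
in `{0, …, τ - 1}`. -/
def rho (τ : ℕ) (D : MultiDigraph V A) (w : A → ℕ) : ℚ :=
  (1 / (τ : ℚ)) *
    ∑ v : V, ((((weight w (D.outCut {v}) : ℤ) - (weight w (D.inCut {v}) : ℤ)) % (τ : ℤ) : ℤ) : ℚ)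

/-- The family `J` of `ν` (not necessarily distinct) arc subsets is a `w`-weighted packing of
dijoins: all members are dijoins and each arc `a` belongs to at most `w a` of them. -/
def IsWeightedDijoinPacking [DecidableEq A] (D : MultiDigraph V A) (w : A → ℕ) {ν : ℕ}
    (J : Fin ν → Finset A) : Prop :=
  (∀ i, D.IsDijoin (J i)) ∧ ∀ a, (Finset.univ.filter (fun i => a ∈ J i)).card ≤ w a

end MultiDigraph

/-! Write the net outflow of `w` at `v` as `τ f(v) + m(v)` with residue `0 ≤ m(v) < τ`. Net outflows
sum to zero, so `f(V) = -k` and `m(V) = kτ`, where `k = ρ ≤ 2`. If no arc leaves `W`, the arcs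
entering it form a dicut, so `m(W) ≤ τ(-1 - f(W))`.

It suffices to peel off `τ` integral flows within `w`, each with net outflow `f + q` for some
integral `q ≥ 0` with `q(W) ≤ -1 - f(W)`: each enters every such `W`, so its support is a dijoin
(`exists_decomposition`). By `exists_flow`, a flow for `q` exists if `q(U) ≤ w(δ⁺(U)) - f(U)` for
all `U`. With `t` flows still to be found, `m / t` satisfies both systems of bounds fractionally,
and an integral `q` is needed that also leaves `m - q` feasible for `t - 1`
(`exists_integral_part`).

This is where `k ≤ 2` enters. As `q(V) = k`, only bounds of value 0 or 1 matter. Those of value 0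
are automatic from `q ≤ m`. When `k = 2`, uncrossing turns the bounds of value 1 in each system into
an equivalence relation on the `2t` copies counted by `m`, with classes of size at most `t`;
choosing `q` becomes choosing a pair separated by both relations (`exists_unrelated_pair`). -/

namespace MultiDigraph

/-! ### Integral rounding under two crossing submodular systems. -/

section Combinatorics

/-- If a type of size `2t` carries two equivalence relations whose classes have at most `t`
elements, some pair is unrelated under both and meets every class of size `t` of the second. -/
theorem exists_unrelated_pair {X : Type*} [Fintype X] (r s : Setoid X) [DecidableRel r.r]
    [DecidableRel s.r] (t : ℕ) (ht : 1 ≤ t) (hX : Fintype.card X = 2 * t)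
    (hr : ∀ x, (Finset.univ.filter (fun y => r.r x y)).card ≤ t)
    (hs : ∀ x, (Finset.univ.filter (fun y => s.r x y)).card ≤ t) :
    ∃ x y, ¬ r.r x y ∧ ¬ s.r x y ∧
      ∀ z, (Finset.univ.filter (fun y => s.r z y)).card = t → s.r z x ∨ s.r z y := by
  classical
  have hnot : ∀ (p : X → Prop) [DecidablePred p], (Finset.univ.filter p).card ≤ t →
      ∃ y, ¬ p y := by
    intro p _ hp
    by_contra! hall
    rw [Finset.filter_true_of_mem (fun y _ => hall y), Finset.card_univ] at hp
    omega
  by_cases htight : ∃ z, (Finset.univ.filter (fun y => s.r z y)).card = t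
  · obtain ⟨z, hz⟩ := htight
    obtain ⟨y₀, hy₀⟩ := hnot _ hz.le
    -- Were every element of the tight class `r`-related to every element outside it, all of `X`
    -- would be one `r`-class, of size `2t > t`.
    have key : ∃ x y, s.r z x ∧ ¬ s.r z y ∧ ¬ r.r x y := by
      by_contra! hall
      obtain ⟨y, hy⟩ := hnot _ (hr z)
      by_cases hzy : s.r z y
      · exact hy (r.trans (hall z y₀ (s.refl z) hy₀) (r.symm (hall y y₀ hzy hy₀)))
      · exact hy (hall z y (s.refl z) hzy)
    obtain ⟨x, y, hx, hy, hxy⟩ := key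
    refine ⟨x, y, hxy, fun h => hy (s.trans hx h), fun z' hz' => ?_⟩
    by_contra! hcon
    have hdisj : Disjoint (Finset.univ.filter (fun y => s.r z y))
        (Finset.univ.filter (fun y => s.r z' y)) := by
      rw [Finset.disjoint_left]
      intro a ha hb
      simp only [Finset.mem_filter, Finset.mem_univ, true_and] at ha hb
      exact hcon.1 (s.trans hb (s.trans (s.symm ha) hx))
    -- Two disjoint classes of size `t` would fill `X`, yet `y` lies in neither.
    have hcard := Finset.card_union_of_disjoint hdisj
    have hlt : (Finset.univ.filter (fun y => s.r z y) ∪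
        Finset.univ.filter (fun y => s.r z' y)).card < Fintype.card X := by
      rw [← Finset.card_univ]
      refine Finset.card_lt_card (Finset.ssubset_univ_iff.2 fun h => ?_)
      have := h ▸ Finset.mem_univ y
      simp only [Finset.mem_union, Finset.mem_filter, Finset.mem_univ, true_and] at this
      exact this.elim hy hcon.2
    omega
  · have : 0 < Fintype.card X := by omega
    obtain ⟨x⟩ := Fintype.card_pos_iff.1 this
    obtain ⟨y, hy⟩ := hnot _ (hr x)
    obtain ⟨z, hz⟩ := hnot _ (hs x)
    push Not at htight
    -- With no tight class, separation is all that is needed: if `x, y` and `x, z` are each related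
    -- under one relation, then `y, z` are separated by both.
    by_cases h₁ : s.r x y
    · by_cases h₂ : r.r x z
      · exact ⟨y, z, fun h => hy (r.trans h₂ (r.symm h)), fun h => hz (s.trans h₁ h),
          fun a ha => absurd ha (htight a)⟩
      · exact ⟨x, z, h₂, hz, fun a ha => absurd ha (htight a)⟩
    · exact ⟨x, y, hy, h₁, fun a ha => absurd ha (htight a)⟩

variable {V : Type*} [Fintype V] [DecidableEq V]

/-- `g` is submodular on crossing pairs of members of the crossing family `P`. -/
def IsCrossingSubmodular (P : Finset V → Prop) (g : Finset V → ℤ) : Prop :=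
  ∀ U W, P U → P W → (U ∩ W).Nonempty → U ∪ W ≠ Finset.univ →
    P (U ∩ W) ∧ P (U ∪ W) ∧ g (U ∩ W) + g (U ∪ W) ≤ g U + g W

theorem card_copies (m : V → ℕ) (W : Finset V) :
    (Finset.univ.filter (fun x : Σ v, Fin (m v) => x.1 ∈ W)).card = ∑ v ∈ W, m v := by
  have : Finset.univ.filter (fun x : Σ v, Fin (m v) => x.1 ∈ W) =
      W.sigma (fun v => (Finset.univ : Finset (Fin (m v)))) := by
    ext x
    simp
  rw [this, Finset.card_sigma]
  simp

/-- The members of value one of a crossing submodular system which dominates `m / t` induce an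
equivalence relation with classes of size at most `t` on the copies counted by `m`. -/
theorem exists_setoid_copies {P : Finset V → Prop} {g : Finset V → ℤ}
    (hg : IsCrossingSubmodular P g) (m : V → ℕ) (t : ℕ) (ht : 1 ≤ t)
    (hm : ∑ v, m v = 2 * t) (hP : ∀ W, P W → ((∑ v ∈ W, m v : ℕ) : ℤ) ≤ t * g W) :
    ∃ r : Setoid (Σ v, Fin (m v)),
      (∀ x, (Set.ncard {y | r.r x y}) ≤ t) ∧
      ∀ W, P W → g W = 1 → ∀ x y : Σ v, Fin (m v), x.1 ∈ W → y.1 ∈ W → r.r x y := by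
  classical
  have hunion : ∀ U W (x : Σ v, Fin (m v)), P U → g U = 1 → P W → g W = 1 → x.1 ∈ U → x.1 ∈ W →
      P (U ∪ W) ∧ g (U ∪ W) = 1 := by
    intro U W x hU hgU hW hgW hxU hxW
    have hpos : ∀ S : Finset V, x.1 ∈ S → 1 ≤ ∑ v ∈ S, m v := fun S hS =>
      le_trans (Nat.succ_le_of_lt (Fin.pos x.2))
        (Finset.single_le_sum (f := m) (fun _ _ => Nat.zero_le _) hS)
    have hxI : x.1 ∈ U ∩ W := Finset.mem_inter.2 ⟨hxU, hxW⟩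
    have hxN : x.1 ∈ U ∪ W := Finset.mem_union_left _ hxU
    have hsum := Finset.sum_union_inter (s₁ := U) (s₂ := W) (f := m)
    have h₁ := hP U hU
    have h₂ := hP W hW
    rw [hgU, mul_one] at h₁
    rw [hgW, mul_one] at h₂
    have hI := hpos _ hxI
    -- A union equal to `V` would carry `m`-mass `2t`, forcing `m(U ∩ W) = 0`, but the intersection
    -- contains the copy `x`.
    have hne : U ∪ W ≠ Finset.univ := by
      intro h
      rw [h, hm] at hsum
      omega
    obtain ⟨hPI, hPN, hle⟩ := hg U W hU hW ⟨_, hxI⟩ hne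
    -- Positive mass forces value at least 1, so submodularity leaves value exactly 1 for the union.
    have hge : ∀ S, P S → x.1 ∈ S → 1 ≤ g S := by
      intro S hS hxS
      have h₃ := hP S hS
      have h₄ := hpos S hxS
      by_contra! hlt
      have : (t : ℤ) * g S ≤ 0 := mul_nonpos_of_nonneg_of_nonpos (by positivity) (by omega)
      omega
    refine ⟨hPN, ?_⟩
    have := hge _ hPI hxI
    have := hge _ hPN hxN
    omega
  let rel : (Σ v, Fin (m v)) → (Σ v, Fin (m v)) → Prop := fun x y =>
    x = y ∨ ∃ W, P W ∧ g W = 1 ∧ x.1 ∈ W ∧ y.1 ∈ W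
  have htrans : ∀ x y z, rel x y → rel y z → rel x z := by
    rintro x y z (rfl | ⟨U, hU, hgU, hx, hy⟩) (rfl | ⟨W, hW, hgW, hy', hz⟩)
    · exact Or.inl rfl
    · exact Or.inr ⟨W, hW, hgW, hy', hz⟩
    · exact Or.inr ⟨U, hU, hgU, hx, hy⟩
    · obtain ⟨h₁, h₂⟩ := hunion U W y hU hgU hW hgW hy hy'
      exact Or.inr ⟨U ∪ W, h₁, h₂, Finset.mem_union_left _ hx, Finset.mem_union_right _ hz⟩
  have hsymm : ∀ x y, rel x y → rel y x := by
    rintro x y (rfl | ⟨U, hU, hgU, hx, hy⟩)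
    · exact Or.inl rfl
    · exact Or.inr ⟨U, hU, hgU, hy, hx⟩
  refine ⟨⟨rel, ⟨fun x => Or.inl rfl, fun {x y} => hsymm x y, fun {x y z} => htrans x y z⟩⟩,
    fun x => ?_, fun W hW hgW x y hx hy => Or.inr ⟨W, hW, hgW, hx, hy⟩⟩
  change Set.ncard {y | rel x y} ≤ t
  by_cases hx : ∃ W, P W ∧ g W = 1 ∧ x.1 ∈ W
  -- A largest value-one member containing `x` absorbs all others, so it contains the class of `x`,
  -- and its mass is at most `t`.
  · obtain ⟨W, hWmem, hmax⟩ := (Finset.univ.filter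
      (fun W => P W ∧ g W = 1 ∧ x.1 ∈ W)).exists_max_image Finset.card
      (by obtain ⟨W, hW⟩ := hx; exact ⟨W, by simpa using hW⟩)
    simp only [Finset.mem_filter, Finset.mem_univ, true_and] at hWmem hmax
    obtain ⟨hW, hgW, hxW⟩ := hWmem
    have hsub : {y | rel x y} ⊆
        (↑(Finset.univ.filter (fun y : Σ v, Fin (m v) => y.1 ∈ W)) : Set _) := by
      rintro y (rfl | ⟨U, hU, hgU, hxU, hyU⟩)
      · simpa using hxW
      · obtain ⟨h₁, h₂⟩ := hunion W U x hW hgW hU hgU hxW hxU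
        have hle := hmax _ ⟨h₁, h₂, Finset.mem_union_left _ hxW⟩
        have heq := Finset.eq_of_subset_of_card_le Finset.subset_union_left hle
        have : y.1 ∈ W := by
          rw [heq]
          exact Finset.mem_union_right _ hyU
        simpa using this
    have := Set.ncard_le_ncard hsub (Finset.finite_toSet _)
    rw [Set.ncard_coe_finset, card_copies] at this
    have h₁ := hP W hW
    rw [hgW, mul_one] at h₁
    omega
  · have hsub : {y | rel x y} ⊆ {x} := by
      rintro y (rfl | ⟨U, hU, hgU, hxU, hyU⟩)
      · rfl
      · exact absurd ⟨U, hU, hgU, hxU⟩ hx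
    have := Set.ncard_le_ncard hsub (Set.finite_singleton x)
    rw [Set.ncard_singleton] at this
    omega

/-- An integral vector `q ≤ m` of total `k ≤ 2` obeying the bounds `h` and `g`, whose removal from
`m` leaves `m - q` within `(t - 1) g`. -/
theorem exists_integral_part {P Q : Finset V → Prop} {h g : Finset V → ℤ}
    (hh : IsCrossingSubmodular P h) (hg : IsCrossingSubmodular Q g) (m : V → ℕ) (t k : ℕ)
    (ht : 1 ≤ t) (hk : k ≤ 2) (hm : ∑ v, m v = k * t)
    (hP : ∀ W, P W → ((∑ v ∈ W, m v : ℕ) : ℤ) ≤ t * h W)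
    (hQ : ∀ W, Q W → ((∑ v ∈ W, m v : ℕ) : ℤ) ≤ t * g W) :
    ∃ q : V → ℕ, (∀ v, q v ≤ m v) ∧ ∑ v, q v = k ∧
      (∀ W, P W → ((∑ v ∈ W, q v : ℕ) : ℤ) ≤ h W) ∧
      (∀ W, Q W → ((∑ v ∈ W, q v : ℕ) : ℤ) ≤ g W) ∧
      ∀ W, Q W → ((∑ v ∈ W, (m v - q v) : ℕ) : ℤ) ≤ ((t - 1 : ℕ) : ℤ) * g W := by
  classical
  -- Bounds of value at least `k` are automatic, since `q` has total `k` and `m - q` has total `(t -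
  -- 1) k`.
  suffices H : ∃ q : V → ℕ, (∀ v, q v ≤ m v) ∧ ∑ v, q v = k ∧
      (∀ W, P W → h W < k → ((∑ v ∈ W, q v : ℕ) : ℤ) ≤ h W) ∧
      ∀ W, Q W → g W < k → ((∑ v ∈ W, q v : ℕ) : ℤ) ≤ g W ∧
        ((∑ v ∈ W, (m v - q v) : ℕ) : ℤ) ≤ ((t - 1 : ℕ) : ℤ) * g W by
    obtain ⟨q, hqm, hqk, h₁, h₂⟩ := H
    have hle : ∀ W : Finset V, ∑ v ∈ W, q v ≤ k := fun W => by
      rw [← hqk]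
      exact Finset.sum_le_sum_of_subset (Finset.subset_univ W)
    refine ⟨q, hqm, hqk, fun W hW => ?_, fun W hW => ?_, fun W hW => ?_⟩
    · by_cases hlt : h W < k
      · exact h₁ W hW hlt
      · have := hle W
        omega
    · by_cases hlt : g W < k
      · exact (h₂ W hW hlt).1
      · have := hle W
        omega
    · by_cases hlt : g W < k
      · exact (h₂ W hW hlt).2
      · have h₃ : ∑ v ∈ W, (m v - q v) ≤ ∑ v, (m v - q v) :=
          Finset.sum_le_sum_of_subset (Finset.subset_univ W)
        rw [Finset.sum_tsub_distrib Finset.univ (fun v _ => hqm v), hm, hqk] at h₃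
        have h₄ : k * t - k = (t - 1) * k := by
          rw [Nat.sub_mul, one_mul, mul_comm]
        rw [h₄] at h₃
        have h₅ : ((t - 1 : ℕ) : ℤ) * k ≤ ((t - 1 : ℕ) : ℤ) * g W :=
          mul_le_mul_of_nonneg_left (by omega) (by positivity)
        refine le_trans ?_ h₅
        exact_mod_cast h₃
  have hnonneg : ∀ (W : Finset V) (c : ℤ), ((∑ v ∈ W, m v : ℕ) : ℤ) ≤ t * c → 0 ≤ c := by
    intro W c hc
    by_contra! hlt
    have : (t : ℤ) * c < 0 := mul_neg_of_pos_of_neg (by omega) hlt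
    omega
  have hzero : ∀ (q : V → ℕ), (∀ v, q v ≤ m v) → ∀ W, ((∑ v ∈ W, m v : ℕ) : ℤ) ≤ t * 0 →
      ∑ v ∈ W, q v = 0 ∧ ∑ v ∈ W, (m v - q v) = 0 := by
    intro q hq W hW
    have h₁ : ∑ v ∈ W, q v ≤ ∑ v ∈ W, m v := Finset.sum_le_sum fun v _ => hq v
    have h₂ : ∑ v ∈ W, (m v - q v) ≤ ∑ v ∈ W, m v :=
      Finset.sum_le_sum fun v _ => Nat.sub_le _ _
    rw [mul_zero] at hW
    omega
  have hlow : ∀ (q : V → ℕ), (∀ v, q v ≤ m v) → ∑ v, q v = k →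
      (∀ W, P W → h W = 1 → k = 2 → ∑ v ∈ W, q v ≤ 1) →
      (∀ W, Q W → g W = 1 → k = 2 → ∑ v ∈ W, q v ≤ 1 ∧ ∑ v ∈ W, (m v - q v) ≤ t - 1) →
      ∃ q : V → ℕ, (∀ v, q v ≤ m v) ∧ ∑ v, q v = k ∧
      (∀ W, P W → h W < k → ((∑ v ∈ W, q v : ℕ) : ℤ) ≤ h W) ∧
      ∀ W, Q W → g W < k → ((∑ v ∈ W, q v : ℕ) : ℤ) ≤ g W ∧
        ((∑ v ∈ W, (m v - q v) : ℕ) : ℤ) ≤ ((t - 1 : ℕ) : ℤ) * g W := by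
    intro q hq hqk h₁ h₂
    refine ⟨q, hq, hqk, fun W hW hlt => ?_, fun W hW hlt => ?_⟩
    · have h₀ := hnonneg _ _ (hP W hW)
      obtain h | ⟨h, h'⟩ : h W = 0 ∨ (h W = 1 ∧ k = 2) := by omega
      · rw [h, (hzero q hq W (h ▸ hP W hW)).1]
        simp
      · rw [h]
        exact_mod_cast h₁ W hW h h'
    · have h₀ := hnonneg _ _ (hQ W hW)
      obtain h | ⟨h, h'⟩ : g W = 0 ∨ (g W = 1 ∧ k = 2) := by omega
      · rw [h, (hzero q hq W (h ▸ hQ W hW)).1, (hzero q hq W (h ▸ hQ W hW)).2]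
        simp
      · rw [h, mul_one]
        exact_mod_cast h₂ W hW h h'
  obtain rfl | rfl | rfl : k = 0 ∨ k = 1 ∨ k = 2 := by omega
  · exact hlow (fun _ => 0) (fun _ => Nat.zero_le _) (by simp) (by simp) (by simp)
  · obtain ⟨u, hu⟩ : ∃ u, 1 ≤ m u := by
      by_contra! hall
      have : ∑ v, m v = 0 := Finset.sum_eq_zero fun v _ => by have := hall v; omega
      omega
    refine hlow (fun v => if v = u then 1 else 0) (fun v => ?_) (by simp) (by simp) (by simp)
    by_cases hv : v = u
    · simpa [hv] using hu
    · simp [hv]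
  · obtain ⟨r, hr, hr'⟩ := exists_setoid_copies hh m t ht hm hP
    obtain ⟨s, hs, hs'⟩ := exists_setoid_copies hg m t ht hm hQ
    have hcard : Fintype.card (Σ v, Fin (m v)) = 2 * t := by
      simpa using hm
    have hncard : ∀ (s : Setoid (Σ v, Fin (m v))) x, Set.ncard {y | s.r x y} =
        (Finset.univ.filter (fun y => s.r x y)).card := by
      intro s x
      rw [← Set.ncard_coe_finset]
      simp
    obtain ⟨x, y, hxy, hxy', htight⟩ := exists_unrelated_pair r s t ht hcard
      (fun x => (hncard r x) ▸ hr x) (fun x => (hncard s x) ▸ hs x)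
    let q : V → ℕ := fun v => (if x.1 = v then 1 else 0) + (if y.1 = v then 1 else 0)
    have hqsum : ∀ W, ∑ v ∈ W, q v = (if x.1 ∈ W then 1 else 0) + (if y.1 ∈ W then 1 else 0) := by
      intro W
      simp [q, Finset.sum_add_distrib]
    -- The two chosen copies are distinct even when they lie over the same vertex.
    have hqm : ∀ v, q v ≤ m v := by
      intro v
      have hne : x ≠ y := fun hxy₀ => hxy (hxy₀ ▸ r.refl x)
      have h₁ := card_copies m {v}
      simp only [Finset.sum_singleton, Finset.mem_singleton] at h₁
      rw [← h₁]
      have h₂ : q v = (({x, y} : Finset (Σ v, Fin (m v))).filter (fun x => x.1 = v)).card := by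
        rw [Finset.card_filter, Finset.sum_pair hne]
      rw [h₂]
      exact Finset.card_le_card (Finset.filter_subset_filter _ (Finset.subset_univ _))
    refine hlow q hqm (by rw [hqsum]; simp) (fun W hW hW₁ _ => ?_) (fun W hW hW₁ _ => ?_)
    · rw [hqsum]
      by_cases hx : x.1 ∈ W <;> by_cases hy : y.1 ∈ W <;> simp [hx, hy]
      exact hxy (hr' W hW hW₁ x y hx hy)
    · refine ⟨?_, ?_⟩
      · rw [hqsum]
        by_cases hx : x.1 ∈ W <;> by_cases hy : y.1 ∈ W <;> simp [hx, hy]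
        exact hxy' (hs' W hW hW₁ x y hx hy)
      · rw [Finset.sum_tsub_distrib _ (fun v _ => hqm v)]
        have hle := hQ W hW
        rw [hW₁, mul_one] at hle
        have hle' : ∑ v ∈ W, m v ≤ t := by exact_mod_cast hle
        -- A tight `W` is an entire `s`-class of size `t`, so the pair meets it and its mass drops
        -- to at most `t - 1`; otherwise the mass is already that small.
        by_cases heq : ∑ v ∈ W, m v = t
        · have hpos : 0 < (Finset.univ.filter
              (fun x : Σ v, Fin (m v) => x.1 ∈ W)).card := by
            rw [card_copies]
            omega
          obtain ⟨z, hz⟩ := Finset.card_pos.1 hpos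
          have hzW : z.1 ∈ W := by simpa using hz
          have hclass : Finset.univ.filter (fun x : Σ v, Fin (m v) => x.1 ∈ W) =
              Finset.univ.filter (fun y => s.r z y) := by
            refine Finset.eq_of_subset_of_card_le (fun a ha => ?_) ?_
            · simp only [Finset.mem_filter, Finset.mem_univ, true_and] at ha ⊢
              exact hs' W hW hW₁ z a hzW ha
            · rw [card_copies, heq, ← hncard]
              exact hs z
          have hmem : ∀ a, s.r z a → a.1 ∈ W := by
            intro a ha
            have : a ∈ Finset.univ.filter (fun y => s.r z y) := by simpa using ha
            rw [← hclass] at this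
            simpa using this
          have hq1 : 1 ≤ ∑ v ∈ W, q v := by
            rw [hqsum]
            rcases htight z (by rw [← hclass, card_copies, heq]) with h | h
            · simp [hmem _ h]
            · simp [hmem _ h]
          omega
        · omega

end Combinatorics

/-! ### Net outflow and submodularity of cuts. -/

variable {V A : Type*} [DecidableEq V] [Fintype A]

/-- The net outflow of `w` at the vertex `v`. -/
def net (D : MultiDigraph V A) (w : A → ℕ) (v : V) : ℤ :=
  (weight w (D.outCut {v}) : ℤ) - weight w (D.inCut {v})

theorem weight_outCut (D : MultiDigraph V A) (w : A → ℕ) (U : Finset V) :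
    weight w (D.outCut U) = ∑ a, if D.tail a ∈ U ∧ D.head a ∉ U then w a else 0 := by
  rw [weight, outCut, Finset.sum_filter]

theorem weight_inCut (D : MultiDigraph V A) (w : A → ℕ) (U : Finset V) :
    weight w (D.inCut U) = ∑ a, if D.head a ∈ U ∧ D.tail a ∉ U then w a else 0 := by
  rw [weight, inCut, Finset.sum_filter]

theorem weight_outCut_sub_weight_inCut (D : MultiDigraph V A) (w : A → ℕ) (U : Finset V) :
    (weight w (D.outCut U) : ℤ) - weight w (D.inCut U) =
      ∑ a, (w a : ℤ) * ((if D.tail a ∈ U then 1 else 0) - (if D.head a ∈ U then 1 else 0)) := by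
  rw [weight_outCut, weight_inCut]
  push_cast
  rw [← Finset.sum_sub_distrib]
  refine Finset.sum_congr rfl fun a _ => ?_
  by_cases h₁ : D.tail a ∈ U <;> by_cases h₂ : D.head a ∈ U <;> simp [h₁, h₂]

theorem net_eq (D : MultiDigraph V A) (w : A → ℕ) (v : V) :
    D.net w v =
      ∑ a, (w a : ℤ) * ((if D.tail a = v then 1 else 0) - (if D.head a = v then 1 else 0)) := by
  rw [net, weight_outCut_sub_weight_inCut]
  simp

theorem sum_net (D : MultiDigraph V A) (w : A → ℕ) (U : Finset V) :
    ∑ v ∈ U, D.net w v = (weight w (D.outCut U) : ℤ) - weight w (D.inCut U) := by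
  rw [weight_outCut_sub_weight_inCut]
  simp_rw [net_eq]
  rw [Finset.sum_comm]
  refine Finset.sum_congr rfl fun a _ => ?_
  rw [← Finset.mul_sum, Finset.sum_sub_distrib]
  simp

theorem outCut_inter_union_eq_empty (D : MultiDigraph V A) {U W : Finset V}
    (hU : D.outCut U = ∅) (hW : D.outCut W = ∅) :
    D.outCut (U ∩ W) = ∅ ∧ D.outCut (U ∪ W) = ∅ := by
  simp only [outCut, Finset.filter_eq_empty_iff, Finset.mem_univ, true_imp_iff, Finset.mem_inter,
    Finset.mem_union] at hU hW ⊢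
  refine ⟨fun a h => ?_, fun a h => ?_⟩
  · have := @hU a
    have := @hW a
    tauto
  · have := @hU a
    have := @hW a
    tauto

theorem net_sub (D : MultiDigraph V A) {w y : A → ℕ} (hy : ∀ a, y a ≤ w a) (v : V) :
    D.net (fun a => w a - y a) v = D.net w v - D.net y v := by
  simp_rw [net_eq]
  rw [← Finset.sum_sub_distrib]
  refine Finset.sum_congr rfl fun a _ => ?_
  rw [Nat.cast_sub (hy a)]
  ring

theorem weight_outCut_inter_add_union_le (D : MultiDigraph V A) (w : A → ℕ) (U W : Finset V) :
    weight w (D.outCut (U ∩ W)) + weight w (D.outCut (U ∪ W)) ≤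
      weight w (D.outCut U) + weight w (D.outCut W) := by
  simp_rw [weight_outCut]
  rw [← Finset.sum_add_distrib, ← Finset.sum_add_distrib]
  refine Finset.sum_le_sum fun a _ => ?_
  by_cases h₁ : D.tail a ∈ U <;> by_cases h₂ : D.head a ∈ U <;>
    by_cases h₃ : D.tail a ∈ W <;> by_cases h₄ : D.head a ∈ W <;> simp [h₁, h₂, h₃, h₄]

/-- An arc leaving `U` and entering `W` counts on the right but leaves neither the intersection nor
the union. Hence it cannot leave one tight set and enter another. -/
theorem weight_outCut_inter_add_union_lt (D : MultiDigraph V A) (w : A → ℕ) (U W : Finset V)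
    (a : A) (ha : 0 < w a) (h₁ : D.tail a ∈ U) (h₂ : D.head a ∉ U) (h₃ : D.tail a ∉ W)
    (h₄ : D.head a ∈ W) :
    weight w (D.outCut (U ∩ W)) + weight w (D.outCut (U ∪ W)) <
      weight w (D.outCut U) + weight w (D.outCut W) := by
  simp_rw [weight_outCut]
  rw [← Finset.sum_add_distrib, ← Finset.sum_add_distrib]
  refine Finset.sum_lt_sum (fun a _ => ?_) ⟨a, Finset.mem_univ a, by simpa [h₁, h₂, h₃, h₄]⟩
  by_cases h₁ : D.tail a ∈ U <;> by_cases h₂ : D.head a ∈ U <;>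
    by_cases h₃ : D.tail a ∈ W <;> by_cases h₄ : D.head a ∈ W <;> simp [h₁, h₂, h₃, h₄]

/-! ### Existence of integral flows. -/

variable [Fintype V]

theorem sum_net_univ (D : MultiDigraph V A) (w : A → ℕ) : ∑ v, D.net w v = 0 := by
  rw [sum_net, weight_outCut_sub_weight_inCut]
  simp

/-- Integral flows with prescribed net outflow `b` and capacity `w` exist under the cut
condition. -/
theorem exists_flow (D : MultiDigraph V A) (w : A → ℕ) (b : V → ℤ) (hb : ∑ v, b v = 0)
    (hcut : ∀ U : Finset V, ∑ v ∈ U, b v ≤ weight w (D.outCut U)) :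
    ∃ y : A → ℕ, (∀ a, y a ≤ w a) ∧ ∀ v, D.net y v = b v := by
  classical
  induction hn : ∑ a, w a generalizing w b with
  | zero =>
    have hw : ∀ a, w a = 0 := by simpa using hn
    have hle : ∀ v, b v ≤ 0 := fun v => by
      have := hcut {v}
      simpa [weight_outCut, hw] using this
    have hb0 := (Finset.sum_eq_zero_iff_of_nonpos (fun v _ => hle v)).1 hb
    exact ⟨fun _ => 0, fun _ => Nat.zero_le _, fun v => by
      rw [net_eq, hb0 v (Finset.mem_univ v)]; simp⟩
  | succ n ih =>
    obtain ⟨a, ha⟩ : ∃ a, 0 < w a := by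
      by_contra! hall
      have : ∑ a, w a = 0 := Finset.sum_eq_zero fun a _ => by have := hall a; omega
      omega
    let w' : A → ℕ := fun c => w c - if c = a then 1 else 0
    have hle : ∀ c, (if c = a then 1 else 0) ≤ w c := by
      intro c
      by_cases hc : c = a
      · rw [if_pos hc, hc]
        exact ha
      · simp [hc]
    have hn' : ∑ c, w' c = n := by
      rw [Finset.sum_tsub_distrib _ (fun c _ => hle c), hn]
      simp
    have hw' : ∀ U, (weight w' (D.outCut U) : ℤ) = weight w (D.outCut U) -
        if D.tail a ∈ U ∧ D.head a ∉ U then 1 else 0 := by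
      intro U
      rw [weight, weight, Finset.sum_tsub_distrib _ (fun c _ => hle c), Nat.cast_sub
        (Finset.sum_le_sum fun c _ => hle c)]
      simp [outCut]
    -- If `a` leaves a tight set, one unit is sent along it and the demand is adjusted; otherwise
    -- one unit of its capacity is discarded.
    by_cases hout : ∃ U : Finset V, D.tail a ∈ U ∧ D.head a ∉ U ∧
        ∑ v ∈ U, b v = weight w (D.outCut U)
    · obtain ⟨U, hU₁, hU₂, hU⟩ := hout
      let e : V → ℤ := fun v => (if D.tail a = v then 1 else 0) - (if D.head a = v then 1 else 0)
      have he : ∀ W : Finset V, ∑ v ∈ W, e v =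
          (if D.tail a ∈ W then 1 else 0) - (if D.head a ∈ W then 1 else 0) := by
        intro W
        simp [e, Finset.sum_sub_distrib]
      obtain ⟨y, hy, hyb⟩ := ih w' (fun v => b v - e v)
        (by rw [Finset.sum_sub_distrib, hb, he]; simp) (by
          intro W
          rw [Finset.sum_sub_distrib, he, hw']
          have hW := hcut W
          by_cases h₁ : D.tail a ∈ W <;> by_cases h₂ : D.head a ∈ W <;> simp [h₁, h₂]
          · exact hW
          · exact hW
          -- The only cut condition that could break is at a tight `W` entered by `a`; uncrossing
          -- with the tight `U` excludes it.
          · by_contra! hlt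
            have heq : ∑ v ∈ W, b v = weight w (D.outCut W) := by omega
            have hsub := D.weight_outCut_inter_add_union_lt w U W a ha hU₁ hU₂ h₁ h₂
            have hsum := Finset.sum_union_inter (s₁ := U) (s₂ := W) (f := b)
            have hi := hcut (U ∩ W)
            have hu := hcut (U ∪ W)
            omega
          · exact hW) hn'
      refine ⟨fun c => y c + if c = a then 1 else 0, fun c => ?_, fun v => ?_⟩
      · have h₁ := hy c
        have h₂ := hle c
        simp only [w'] at h₁ ⊢
        omega
      · have h₁ := hyb v
        rw [net_eq] at h₁ ⊢
        push_cast
        simp_rw [add_mul]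
        rw [Finset.sum_add_distrib, h₁]
        simp [e]
    · push Not at hout
      obtain ⟨y, hy, hyb⟩ := ih w' b hb (by
        intro W
        rw [hw']
        have hW := hcut W
        by_cases h : D.tail a ∈ W ∧ D.head a ∉ W
        · have := hout W h.1 h.2
          rw [if_pos h]
          omega
        · rw [if_neg h]
          omega) hn'
      exact ⟨y, fun c => (hy c).trans (Nat.sub_le _ _), hyb⟩

/-! ### Peeling off flows one at a time. -/

/-- Splitting `w` into `t` integral flows, each entering every set that no arc leaves. -/
theorem exists_decomposition (D : MultiDigraph V A) (f : V → ℤ) (k : ℕ) (hk : k ≤ 2)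
    (hf : ∑ v, f v = -k) (t : ℕ) (w : A → ℕ) (m : V → ℕ)
    (hnet : ∀ v, D.net w v = t * f v + m v)
    (hm : ∀ W : Finset V, W.Nonempty → W ≠ Finset.univ → D.outCut W = ∅ →
      ((∑ v ∈ W, m v : ℕ) : ℤ) ≤ t * (-1 - ∑ v ∈ W, f v)) :
    ∃ y : Fin t → A → ℕ, (∀ a, ∑ i, y i a ≤ w a) ∧
      ∀ i, ∀ W : Finset V, W.Nonempty → W ≠ Finset.univ → D.outCut W = ∅ →
        1 ≤ weight (y i) (D.inCut W) := by
  induction t generalizing w m with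
  | zero => exact ⟨fun i => i.elim0, fun a => by simp, fun i => i.elim0⟩
  | succ t ih =>
    have hsumnet : ∀ U : Finset V, ((t + 1 : ℕ) : ℤ) * ∑ v ∈ U, f v + (∑ v ∈ U, m v : ℕ) =
        (weight w (D.outCut U) : ℤ) - weight w (D.inCut U) := by
      intro U
      rw [← sum_net, Finset.sum_congr rfl (fun v _ => hnet v), Finset.sum_add_distrib,
        ← Finset.mul_sum]
      push_cast
      rfl
    have hmsum : ∑ v, m v = k * (t + 1) := by
      have h₁ := hsumnet Finset.univ
      rw [← sum_net, sum_net_univ, hf] at h₁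
      have h₂ : ((∑ v, m v : ℕ) : ℤ) = ((k * (t + 1) : ℕ) : ℤ) := by
        push_cast at h₁ ⊢
        linarith
      exact_mod_cast h₂
    have hh : IsCrossingSubmodular (fun _ : Finset V => True)
        (fun U => (weight w (D.outCut U) : ℤ) - ∑ v ∈ U, f v) := by
      intro U W _ _ _ _
      refine ⟨trivial, trivial, ?_⟩
      have h₁ := D.weight_outCut_inter_add_union_le w U W
      have h₂ := Finset.sum_union_inter (s₁ := U) (s₂ := W) (f := f)
      simp only
      omega
    have hg : IsCrossingSubmodular
        (fun W : Finset V => W.Nonempty ∧ W ≠ Finset.univ ∧ D.outCut W = ∅)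
        (fun W => -1 - ∑ v ∈ W, f v) := by
      intro U W hU hW hI hN
      obtain ⟨h₁, h₂⟩ := D.outCut_inter_union_eq_empty hU.2.2 hW.2.2
      refine ⟨⟨hI, fun h => hU.2.1 ?_, h₁⟩, ⟨hU.1.mono Finset.subset_union_left, hN, h₂⟩, ?_⟩
      · exact Finset.univ_subset_iff.1 (h ▸ Finset.inter_subset_left)
      · have h₂ := Finset.sum_union_inter (s₁ := U) (s₂ := W) (f := f)
        simp only
        omega
    obtain ⟨q, hqm, hqk, hq₁, hq₂, hq₃⟩ := exists_integral_part hh hg m (t + 1) k (by omega) hk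
      hmsum (by
        intro W _
        have h₁ := hsumnet W
        -- `w` itself, scaled down by `t + 1`, witnesses the bound: `(t + 1) f(W) + m(W) ≤ w(δ⁺(W))
        -- ≤ (t + 1) w(δ⁺(W))`.
        have h₂ : (0 : ℤ) ≤ (t : ℤ) * weight w (D.outCut W) := by positivity
        have h₃ : (0 : ℤ) ≤ weight w (D.inCut W) := by positivity
        push_cast at h₁ ⊢
        nlinarith) (fun W hW => hm W hW.1 hW.2.1 hW.2.2)
    obtain ⟨y, hyw, hy⟩ := D.exists_flow w (fun v => f v + q v) (by
        rw [Finset.sum_add_distrib, hf, ← Nat.cast_sum, hqk]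
        ring) (by
        intro U
        have := hq₁ U trivial
        rw [Finset.sum_add_distrib, ← Nat.cast_sum]
        omega)
    -- The remaining capacity has net outflow `t f + (m - q)`, so the same `f` serves throughout.
    obtain ⟨z, hzw, hz⟩ := ih (fun a => w a - y a) (fun v => m v - q v) (by
        intro v
        rw [D.net_sub hyw, hnet, hy, Nat.cast_sub (hqm v)]
        push_cast
        ring) (by
        intro W h₁ h₂ h₃
        simpa using hq₃ W ⟨h₁, h₂, h₃⟩)
    refine ⟨Fin.cons y z, fun a => ?_, fun i => ?_⟩
    · rw [Fin.sum_univ_succ]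
      simp only [Fin.cons_zero, Fin.cons_succ]
      have h₁ := hzw a
      have h₂ := hyw a
      omega
    · refine Fin.cases ?_ (fun j => ?_) i
      · intro W h₁ h₂ h₃
        -- The net outflow of `y` from `W` is `f(W) + q(W) ≤ -1`, and no arc leaves `W`.
        have h₄ := hq₂ W ⟨h₁, h₂, h₃⟩
        have h₅ := D.sum_net y W
        rw [Finset.sum_congr rfl (fun v _ => hy v), Finset.sum_add_distrib, ← Nat.cast_sum, h₃]
          at h₅
        simp only [weight, Finset.sum_empty] at h₅
        simp only [Fin.cons_zero, weight]
        omega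
      · simpa using hz j

theorem outCut_compl (D : MultiDigraph V A) (U : Finset V) : D.outCut Uᶜ = D.inCut U := by
  ext a
  simp [outCut, inCut, and_comm]

theorem inCut_compl (D : MultiDigraph V A) (U : Finset V) : D.inCut Uᶜ = D.outCut U := by
  ext a
  simp [outCut, inCut, and_comm]

end MultiDigraph

/-! ### Quotients and residues of the net outflow, and dijoins as supports of flows. -/

theorem mainTheorem3 {V A : Type*} [Fintype V] [DecidableEq V] [Fintype A] [DecidableEq A]
    (D : MultiDigraph V A) (w : A → ℕ) (τ : ℕ) (hτ : 2 ≤ τ)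
    (hdicut : ∀ C : Finset A, D.IsDicut C → τ ≤ MultiDigraph.weight w C)
    (hrho : MultiDigraph.rho τ D w ≤ 2) :
    ∃ J : Fin τ → Finset A, D.IsWeightedDijoinPacking w J := by
  have hτ0 : (0 : ℤ) < τ := by omega
  let f : V → ℤ := fun v => D.net w v / τ
  let m : V → ℕ := fun v => (D.net w v % τ).toNat
  have hmc : ∀ v, (m v : ℤ) = D.net w v % τ := fun v =>
    Int.toNat_of_nonneg (Int.emod_nonneg _ hτ0.ne')
  have hnet : ∀ v, D.net w v = τ * f v + m v := fun v => by
    rw [hmc]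
    exact (Int.mul_ediv_add_emod _ _).symm
  have hsum : ∀ U : Finset V, (τ : ℤ) * ∑ v ∈ U, f v + (∑ v ∈ U, m v : ℕ) =
      ∑ v ∈ U, D.net w v := by
    intro U
    rw [Finset.sum_congr rfl (fun v _ => hnet v), Finset.sum_add_distrib, ← Finset.mul_sum]
    push_cast
    rfl
  have htotal := hsum Finset.univ
  rw [D.sum_net_univ] at htotal
  have hm2 : ((∑ v, m v : ℕ) : ℤ) ≤ 2 * τ := by
    have hτq : (0 : ℚ) < τ := by exact_mod_cast hτ0
    have h₁ : MultiDigraph.rho τ D w = (1 / (τ : ℚ)) * ((∑ v, m v : ℕ) : ℚ) := by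
      rw [MultiDigraph.rho]
      push_cast
      congr 1
      refine Finset.sum_congr rfl fun v _ => ?_
      rw [← Int.cast_natCast (R := ℚ) (m v), hmc]
      rfl
    rw [h₁, one_div, inv_mul_le_iff₀ hτq, mul_comm] at hrho
    exact_mod_cast hrho
  have hf0 : ∑ v, f v ≤ 0 := by
    by_contra! hlt
    have : (0 : ℤ) < τ * ∑ v, f v := mul_pos hτ0 hlt
    omega
  have hf2 : -2 ≤ ∑ v, f v := by nlinarith
  obtain ⟨y, hyw, hy⟩ := D.exists_decomposition f (-∑ v, f v).toNat (by omega) (by omega) τ w m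
    hnet (by
      intro W h₁ h₂ h₃
      -- The arcs entering `W` are those leaving its complement, which no arc enters.
      have hC := hdicut (D.inCut W) ⟨Wᶜ, by
          rw [Finset.nonempty_iff_ne_empty, Ne, Finset.compl_eq_empty_iff]; exact h₂, by
          rw [Ne, Finset.compl_eq_univ_iff]; exact h₁.ne_empty, by
          rw [MultiDigraph.inCut_compl, h₃], (MultiDigraph.outCut_compl D W).symm⟩
      have h₄ := hsum W
      rw [D.sum_net, h₃] at h₄
      have h₅ : MultiDigraph.weight w ∅ = 0 := rfl
      rw [h₅] at h₄
      have h₆ : (τ : ℤ) ≤ MultiDigraph.weight w (D.inCut W) := by exact_mod_cast hC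
      push_cast at h₄ ⊢
      linarith)
  -- Passing to supports keeps the capacity bound, as each positive `y i a` is at least 1.
  refine ⟨fun i => Finset.univ.filter (fun a => 0 < y i a), fun i C hC => ?_, fun a => ?_⟩
  · obtain ⟨U, hU₁, hU₂, hU₃, rfl⟩ := hC
    have h := hy i Uᶜ
      (by rw [Finset.nonempty_iff_ne_empty, Ne, Finset.compl_eq_empty_iff]; exact hU₂)
      (by rw [Ne, Finset.compl_eq_univ_iff]; exact hU₁.ne_empty)
      (by rw [MultiDigraph.outCut_compl, hU₃])
    rw [MultiDigraph.inCut_compl] at h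
    by_contra! hall
    have : MultiDigraph.weight (y i) (D.outCut U) = 0 := Finset.sum_eq_zero fun a ha => by
      by_contra hne
      exact hall a (by simpa using Nat.pos_of_ne_zero hne) ha
    omega
  · refine le_trans ?_ (hyw a)
    rw [Finset.card_filter]
    refine Finset.sum_le_sum fun i _ => ?_
    by_cases h : 0 < y i a
    · simpa [h] using Nat.succ_le_of_lt h
    · simp [h]
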